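/- Definitions. A tree is a set $T$ with a strict partial order $<$ in which the predecessors of every node are well-ordered; the rank $\mathrm{rk}(x)$ is the order type of $\{y : y<x\}$ and $T_\beta$ is the set of nodes of rank $\beta$. An $\omega_1$-tree is a nonempty tree all of whose nodes have rank $<\omega_1$, all of whose levels are countable, such that whenever $\mathrm{rk}(x)<\beta<\omega_1$ there are at least two successors of $x$ in $T_\beta$, and such that each node whose rank is a (nonzero) limit ordinal is uniquely determined by its set of predecessors. A Suslin tree is an $\omega_1$-tree with no uncountable chain and no uncountable antichain (set of pairwise incomparable nodes). $H_\kappa$ is the set of all sets whose transitive closure has cardinality $<\kappa$. If $N$ is a countable elementary substructure of $(H_\lambda,\in)$ with $T\in N$ (that is, the pair $(T,<)$ is in $N$), a node $x\in T$ is $(T,N)$-$\#$-generic iff $\mathrm{rk}(x)=\omega_1\cap N$ and for every $A\in N$ with $A\subseteq T$ there is $y<x$ such that $y\in A$ or $(\forall z\ge y)(z\notin A)$. A tree $T$ is sharply Suslin iff $T$ is Suslin and for every sufficiently large regular cardinal $\lambda$ and every countable elementary substructure $M$ of $H_{\lambda^+}$ there is a closed unbounded $C\subseteq\omega_1$ such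 that for every $N\in M$ which is a countable elementary substructure of $H_\lambda$ with $T\in N$ and $\omega_1\cap N\in C$, every $x\in T_{\omega_1\cap N}$ is $(T,N)$-$\#$-generic. $\diamondsuit^*$ is the principle: there is a sequence $\langle S_\alpha:\alpha<\omega_1\rangle$ such that each $S_\alpha$ is a countable subset of $\mathcal P(\alpha)$ and for every $X\subseteq\omega_1$ there is a closed unbounded $C\subseteq\omega_1$ with $X\cap\alpha\in S_\alpha$ for every $\alpha\in C$. Lemma 4.4. If $\diamondsuit^*$ holds, then there is a sharply Suslin tree. -/

import Mathlib

universe u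

open scoped Ordinal Cardinal

/-! ### Closed unbounded sets and the principle diamond-star -/

/-- `DiamondStar` is the principle `◇*`: there is a sequence `⟨S α : α < ω₁⟩` such that each `S α`
is a countable set of subsets of `α`, and for every `X ⊆ ω₁` there is a closed unbounded `C ⊆ ω₁`
with `X ∩ α ∈ S α` for all `α ∈ C`. Here an ordinal `α` is identified with `Set.Iio α`. -/
def DiamondStar : Prop :=
  ∃ S : Set.Iio (ω₁ : Ordinal.{u}) → Set (Set Ordinal.{u}),
    (∀ α, (S α).Countable ∧ ∀ Y ∈ S α, Y ⊆ Set.Iio (α : Ordinal.{u})) ∧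
    ∀ X : Set Ordinal.{u}, X ⊆ Set.Iio ω₁ →
      ∃ C : Set (Set.Iio (ω₁ : Ordinal.{u})), IsClub C ∧
        ∀ α ∈ C, X ∩ Set.Iio (α : Ordinal.{u}) ∈ S α

/-! ### The sets `H_κ` and their countable elementary substructures -/

/-- The relation symbols of the language of set theory: one binary symbol. -/
inductive SetTheoryRel : ℕ → Type
  | mem : SetTheoryRel 2

/-- The first-order language of set theory, with the single relation symbol `∈`. -/
def setTheoryLanguage : FirstOrder.Language := ⟨fun _ => Empty, SetTheoryRel⟩

/-- A collection of sets as a structure for the language of set theory, where the relation symbol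
is interpreted as true membership. -/
instance membershipStructure (H : Set ZFSet.{u}) : setTheoryLanguage.Structure H where
  funMap := fun f => nomatch f
  RelMap := fun R => match R with
    | SetTheoryRel.mem => fun v => (v 0 : ZFSet.{u}) ∈ (v 1 : ZFSet.{u})

/-- `Hset κ` is `H_κ`, the collection of the sets whose transitive closure has cardinality less
than `κ`, i.e. which are included in some transitive set of cardinality less than `κ`. -/
def Hset (κ : Cardinal.{u}) : Set ZFSet.{u} :=
  {x | ∃ t : ZFSet.{u}, t.IsTransitive ∧ x ⊆ t ∧ t.card < κ}

/-- `N` is (the underlying set of) a countable elementary substructure of `(H, ∈)`. -/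
def IsCountableElementary (N : ZFSet.{u}) (H : Set ZFSet.{u}) : Prop :=
  (N : Set ZFSet.{u}).Countable ∧
    ∃ E : setTheoryLanguage.ElementarySubstructure H,
      Subtype.val '' (E : Set H) = (N : Set ZFSet.{u})

/-! ### Trees -/

/-- A tree `(T, <)` whose underlying set and whose order relation (a set of ordered pairs) are
sets: a strict partial order in which the predecessors of every node are well-ordered. -/
structure SetTree where
  /-- The set of nodes. -/
  carrier : ZFSet.{u}
  /-- The strict order, as a set of ordered pairs. -/
  order : ZFSet.{u}
  order_subset : order ⊆ ZFSet.prod carrier carrier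
  irrefl : ∀ x, ZFSet.pair x x ∉ order
  trans : ∀ x y z, ZFSet.pair x y ∈ order → ZFSet.pair y z ∈ order → ZFSet.pair x z ∈ order
  wellOrder : ∀ x, IsWellOrder {y : ZFSet.{u} // ZFSet.pair y x ∈ order}
    (fun a b => ZFSet.pair (a : ZFSet.{u}) (b : ZFSet.{u}) ∈ order)

namespace SetTree

/-- The tree as a single set: the ordered pair `(T, <)`. -/
def code (T : SetTree.{u}) : ZFSet.{u} := ZFSet.pair T.carrier T.order

/-- The strict order of the tree. -/
def Lt (T : SetTree.{u}) (x y : ZFSet.{u}) : Prop := ZFSet.pair x y ∈ T.order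

/-- `T.level β` is `T_β`, the set of the nodes of rank `β`: those whose set of predecessors has
order type `β`. -/
def level (T : SetTree.{u}) (β : Ordinal.{u}) : Set ZFSet.{u} :=
  {x | x ∈ T.carrier ∧
    Nonempty ((fun a b : {y : ZFSet.{u} // T.Lt y x} => T.Lt a b) ≃r
      (fun a b : Set.Iio β => a < b))}

/-- `T` is an `ω₁`-tree: a nonempty tree, all of whose nodes have countable rank, with countable
levels, such that every node has at least two successors on every higher level below `ω₁`, and
such that each node of limit rank is determined by its set of predecessors. -/
structure IsOmegaOneTree (T : SetTree.{u}) : Prop where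
  nonempty : ∃ x, x ∈ T.carrier
  rank_lt : ∀ x ∈ T.carrier, ∃ β < (ω₁ : Ordinal.{u}), x ∈ T.level β
  countable_level : ∀ β < (ω₁ : Ordinal.{u}), (T.level β).Countable
  two_successors : ∀ α β : Ordinal.{u}, α < β → β < ω₁ → ∀ x ∈ T.level α,
    ∃ y ∈ T.level β, ∃ z ∈ T.level β, y ≠ z ∧ T.Lt x y ∧ T.Lt x z
  limit_unique : ∀ β : Ordinal.{u}, Order.IsSuccLimit β → ∀ x ∈ T.level β, ∀ y ∈ T.level β,
    (∀ z, T.Lt z x ↔ T.Lt z y) → x = y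

/-- `T` is a Suslin tree: an `ω₁`-tree with no uncountable chain and no uncountable antichain. -/
structure IsSuslin (T : SetTree.{u}) : Prop where
  isOmegaOneTree : T.IsOmegaOneTree
  chain : ∀ B : Set ZFSet.{u}, B ⊆ (T.carrier : Set ZFSet.{u}) → IsChain T.Lt B → B.Countable
  antichain : ∀ A : Set ZFSet.{u}, A ⊆ (T.carrier : Set ZFSet.{u}) →
    IsAntichain T.Lt A → A.Countable

/-- `x` is `(T, N)`-`#`-generic: `rk x = ω₁ ∩ N`, and for every `A ∈ N` with `A ⊆ T` there is
`y < x` such that `y ∈ A` or no `z ≥ y` is in `A`. -/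
def SharpGeneric (T : SetTree.{u}) (N x : ZFSet.{u}) : Prop :=
  (∃ δ : Ordinal.{u}, (ω₁ : Ordinal.{u}).toZFSet ∩ N = δ.toZFSet ∧ x ∈ T.level δ) ∧
    ∀ A ∈ N, A ⊆ T.carrier →
      ∃ y, T.Lt y x ∧ (y ∈ A ∨ ∀ z, (z = y ∨ T.Lt y z) → z ∉ A)

/-- `T` is sharply Suslin: it is Suslin, and for every sufficiently large regular cardinal `κ` and
every countable elementary substructure `M` of `H_{κ⁺}` there is a closed unbounded `C ⊆ ω₁` such
that for every `N ∈ M` which is a countable elementary substructure of `H_κ` containing `T` and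
satisfies `ω₁ ∩ N ∈ C`, every node of rank `ω₁ ∩ N` is `(T, N)`-`#`-generic. -/
def IsSharplySuslin (T : SetTree.{u}) : Prop :=
  T.IsSuslin ∧
    ∃ κ₀ : Cardinal.{u}, ∀ κ : Cardinal.{u}, κ₀ ≤ κ → κ.IsRegular →
      ∀ M : ZFSet.{u}, IsCountableElementary M (Hset (Order.succ κ)) →
        ∃ C : Set (Set.Iio (ω₁ : Ordinal.{u})), IsClub C ∧
          ∀ N ∈ M, IsCountableElementary N (Hset κ) → T.code ∈ N →
            ∀ δ ∈ C, (ω₁ : Ordinal.{u}).toZFSet ∩ N = (δ : Ordinal.{u}).toZFSet →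
              ∀ x ∈ T.level δ, T.SharpGeneric N x

end SetTree

/-! The tree is built by recursion on levels, each level being a copy of ω, so that subsets of the
tree can be guessed as subsets of ω₁ × ω (`diamondStar_prod`). At a limit level α only countably
many cofinal branches are extended, one through each earlier node. Each is chosen by
Rasiowa–Sikorski to decide the countably many sets in `S α`: it meets the set or reaches a node with
no extension in it below α (`exists_branch`).

Every A is guessed on a club, and for club many α an extension in A of a node below α can already be
found below α. Hence on a club of levels every node decides A from below
(`exists_isClub_decidesBelow`).

This one property yields the rest. Applied to an antichain, or to the set of nodes with no extension
in a given chain, it bounds the levels that occur. For sharpness, the countable N ∈ M have together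
only countably many elements A, and the intersection of their clubs is a club. Guessing on a club,
not just on a stationary set, is what allows this intersection. -/

/-! ### Recursion and closed unbounded sets in well-orders -/

/-- Dependent choice along a well-order, for a property `P b a` which only depends on the values
of `b` up to `a`. -/
theorem exists_forall_of_update {W V : Type*} [LinearOrder W] [WellFoundedLT W] [Nonempty V]
    (P : (W → V) → W → Prop)
    (congr : ∀ b b' a, (∀ c ≤ a, b c = b' c) → P b a → P b' a)
    (step : ∀ b a, (∀ c < a, P b c) → ∃ v, P (Function.update b a v) a) :
    ∃ b, ∀ a, P b a := by
  classical
  -- The values from `a` on are arbitrary; `congr` makes them irrelevant.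
  let ext : ∀ a : W, (∀ c, c < a → V) → W → V := fun a prev c =>
    if h : c < a then prev c h else Classical.arbitrary V
  let F : ∀ a : W, (∀ c, c < a → V) → V := fun a prev =>
    Classical.epsilon fun v => P (Function.update (ext a prev) a v) a
  let b : W → V := (wellFounded_lt (α := W)).fix F
  have hb : ∀ a, b a = F a (fun c _ => b c) := fun a => WellFounded.fix_eq _ _ _
  refine ⟨b, fun a => ?_⟩
  induction a using WellFoundedLT.induction with
  | _ a ih =>
    have hext : ∀ c < a, b c = ext a (fun c _ => b c) c := fun c hc => by simp [ext, hc]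
    have hex := step (ext a fun c _ => b c) a fun c hc =>
      congr b _ c (fun d hd => hext d (hd.trans_lt hc)) (ih c hc)
    refine congr _ b a (fun c hc => ?_) (Classical.epsilon_spec hex)
    rcases hc.eq_or_lt with rfl | hc
    · rw [Function.update_self, hb]
    · rw [Function.update_of_ne hc.ne, hext c hc]

/-- The points closed under a function on an uncountable regular well-order form a club. -/
theorem isClub_closurePoints {W : Type*} [LinearOrder W] [WellFoundedLT W]
    (hW : ∀ s : Set W, s.Countable → ∃ b, ∀ a ∈ s, a < b)
    (hc : ∀ a : W, (Set.Iio a).Countable) (f : W → W) :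
    IsClub {d : W | (∃ a, a < d) ∧ ∀ a < d, f a < d} := by
  constructor
  · intro s hs hne _ d hd
    constructor
    · obtain ⟨e, he⟩ := hne
      obtain ⟨a, ha⟩ := (hs he).1
      exact ⟨a, ha.trans_le (hd.1 he)⟩
    · intro a ha
      obtain ⟨e, he, hae⟩ := (lt_isLUB_iff hd).1 ha
      exact ((hs he).2 a hae).trans_le (hd.1 he)
  · intro a
    have hstep : ∀ x : W, ∃ y, x < y ∧ ∀ z ≤ x, f z < y := by
      intro x
      have hcount : (insert x (f '' Set.Iic x)).Countable := by
        refine (Set.Countable.image ?_ f).insert x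
        rw [← Set.Iio_union_right]
        exact (hc x).union (Set.countable_singleton x)
      obtain ⟨y, hy⟩ := hW _ hcount
      exact ⟨y, hy x (Set.mem_insert _ _), fun z hz =>
        hy _ (Set.mem_insert_of_mem _ ⟨z, hz, rfl⟩)⟩
    choose g hg hfg using hstep
    -- The supremum of the iterates of `g` is closed under `f`: anything below it is below some
    -- iterate, and the next iterate bounds its image.
    let s : ℕ → W := fun n => g^[n] a
    have hs : ∀ n, s (n + 1) = g (s n) := fun n => Function.iterate_succ_apply' g n a
    obtain ⟨u, hu⟩ := hW (Set.range s) (Set.countable_range s)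
    obtain ⟨d, hd, hmin⟩ := (wellFounded_lt (α := W)).has_min (upperBounds (Set.range s))
      ⟨u, fun x hx => (hu x hx).le⟩
    have hlt : ∀ n, s n < d := fun n =>
      (hs n ▸ hg (s n) : s n < s (n + 1)).trans_le (hd ⟨n + 1, rfl⟩)
    refine ⟨d, ⟨⟨a, hlt 0⟩, fun x hx => ?_⟩, (hlt 0).le⟩
    have hx' : x ∉ upperBounds (Set.range s) := fun h => hmin x h hx
    simp only [mem_upperBounds, Set.forall_mem_range, not_forall, not_le] at hx'
    obtain ⟨n, hn⟩ := hx'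
    exact ((hfg (s n) x hn.le).trans_eq (hs n).symm).trans (hlt (n + 1))

/-- The Rasiowa–Sikorski lemma for a reflexive and transitive relation. -/
theorem exists_directed_meeting {P : Type*} (r : P → P → Prop) (refl : ∀ x, r x x)
    (trans : ∀ x y z, r x y → r y z → r x z) (𝒟 : Set (Set P)) (h𝒟 : 𝒟.Countable)
    (dense : ∀ D ∈ 𝒟, ∀ x, ∃ y ∈ D, r x y) (p : P) :
    ∃ I : Set P, p ∈ I ∧ (∀ x ∈ I, ∀ y ∈ I, ∃ z ∈ I, r x z ∧ r y z) ∧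
      (∀ y ∈ I, ∀ x, r x y → x ∈ I) ∧ ∀ D ∈ 𝒟, ∃ x ∈ D, x ∈ I := by
  let _ : Preorder P := { le := r, le_refl := refl, le_trans := trans }
  have := h𝒟.to_subtype
  let _ := Encodable.ofCountable 𝒟
  let 𝒞 : 𝒟 → Order.Cofinal P := fun D => ⟨D.1, fun x => dense D.1 D.2 x⟩
  let I := Order.idealOfCofinals p 𝒞
  exact ⟨I, Order.mem_idealOfCofinals p 𝒞, I.directed, fun y hy x hxy => I.lower hxy hy,
    fun D hD => Order.cofinal_meets_idealOfCofinals p 𝒞 ⟨D, hD⟩⟩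

/-! ### Coherent systems of branches -/

section BranchSystem

variable {W : Type*} [LinearOrder W]

/-- `a` is a limit point of the order: neither minimal nor a successor. -/
def IsLimitPoint (a : W) : Prop :=
  (∃ c, c < a) ∧ ∀ c < a, ∃ d, c < d ∧ d < a

/-- For `b : W → ℕ → W → ℕ`, where `b a n c` is the index of the node at level `c ≤ a` below the
`n`-th node of level `a`: the node `y` extends or equals the node `x`. -/
def NodeLE (b : W → ℕ → W → ℕ) (x y : W × ℕ) : Prop :=
  x.1 ≤ y.1 ∧ b y.1 y.2 x.1 = x.2

/-- The level `a` is a correct continuation of the tree given by `b` below `a`: it is coherent,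
every earlier node splits, and if `a` is a limit point, then the nodes of level `a` are determined
by their predecessors and decide all the sets in `S a`. -/
structure GoodLevel (S : W → Set (Set (W × ℕ))) (b : W → ℕ → W → ℕ) (a : W) : Prop where
  self : ∀ n, b a n a = n
  coherent : ∀ d c, d ≤ c → c < a → ∀ n, b a n d = b c (b a n c) d
  split : ∀ c < a, ∀ m, ∃ n n', n ≠ n' ∧ b a n c = m ∧ b a n' c = m
  inj : IsLimitPoint a → ∀ n n', (∀ c < a, b a n c = b a n' c) → n = n'
  generic : IsLimitPoint a → ∀ A ∈ S a, ∀ n, ∃ c < a, (c, b a n c) ∈ A ∨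
    ∀ z : W × ℕ, z.1 < a → NodeLE b (c, b a n c) z → z ∉ A

variable {S : W → Set (Set (W × ℕ))} {b b' : W → ℕ → W → ℕ} {a : W}

/-- Genericity at `a` only quantifies over nodes below `a`, so the condition is local enough for the
recursion. -/
theorem GoodLevel.congr (h : ∀ c ≤ a, b c = b' c) (hb : GoodLevel S b a) : GoodLevel S b' a := by
  have ha := h a le_rfl
  refine ⟨?_, ?_, ?_, ?_, ?_⟩
  · rw [← ha]; exact hb.self
  · intro d c hdc hc
    rw [← ha, ← h c hc.le]
    exact hb.coherent d c hdc hc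
  · rw [← ha]; exact hb.split
  · rw [← ha]; exact hb.inj
  · intro hl A hA n
    obtain ⟨c, hc, h'⟩ := hb.generic hl A hA n
    rw [← ha]
    refine ⟨c, hc, h'.imp_right fun h' z hz hle => h' z hz ?_⟩
    rwa [NodeLE, h z.1 hz.le]

theorem GoodLevel.coherent_le (hb : GoodLevel S b a) {d c : W} (hdc : d ≤ c) (hc : c ≤ a) (n : ℕ) :
    b a n d = b c (b a n c) d := by
  rcases hc.eq_or_lt with rfl | hc
  · rw [hb.self]
  · exact hb.coherent d c hdc hc n

theorem GoodLevel.exists_eq (hb : GoodLevel S b a) {c : W} (hc : c ≤ a) (m : ℕ) :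
    ∃ n, b a n c = m := by
  rcases hc.eq_or_lt with rfl | hc
  · exact ⟨m, hb.self m⟩
  · obtain ⟨n, _, _, h, _⟩ := hb.split c hc m
    exact ⟨n, h⟩

/-- Every node below a limit level lies on a branch deciding countably many given sets. -/
theorem exists_branch (hcount : (Set.Iio a).Countable) (hS : (S a).Countable)
    (hb : ∀ c < a, GoodLevel S b c) (p : W × ℕ) (hp : p.1 < a) :
    ∃ f : W → ℕ, f p.1 = p.2 ∧ (∀ d c, d ≤ c → c < a → f d = b c (f c) d) ∧
      (∀ A ∈ S a, ∃ c < a, (c, f c) ∈ A ∨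
        ∀ z : W × ℕ, z.1 < a → NodeLE b (c, f c) z → z ∉ A) ∧
      ∀ c, a ≤ c → f c = 0 := by
  classical
  let P := {x : W × ℕ // x.1 < a}
  let r : P → P → Prop := fun x y => NodeLE b x.1 y.1
  let level : W → Set P := fun c => {x | c ≤ x.1.1}
  let decide : Set (W × ℕ) → Set P := fun A =>
    {x | x.1 ∈ A ∨ ∀ z : P, r x z → z.1 ∉ A}
  have hrefl : ∀ x, r x x := fun x => ⟨le_rfl, (hb _ x.2).self _⟩
  have htrans : ∀ x y z, r x y → r y z → r x z := by
    intro x y z hxy hyz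
    refine ⟨hxy.1.trans hyz.1, ?_⟩
    rw [(hb _ z.2).coherent_le hxy.1 hyz.1, hyz.2, hxy.2]
  obtain ⟨I, hpI, hdir, hlow, hmeet⟩ := exists_directed_meeting r hrefl htrans
    (level '' Set.Iio a ∪ decide '' S a) ((hcount.image _).union (hS.image _)) (by
      rintro _ (⟨c, hc, rfl⟩ | ⟨A, -, rfl⟩) x
      · rcases le_total c x.1.1 with h | h
        · exact ⟨x, h, hrefl x⟩
        · obtain ⟨n, hn⟩ := (hb c hc).exists_eq h x.1.2
          exact ⟨⟨(c, n), hc⟩, le_rfl, h, hn⟩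
      · by_cases h : ∃ z : P, r x z ∧ z.1 ∈ A
        · obtain ⟨z, hxz, hz⟩ := h
          exact ⟨z, Or.inl hz, hxz⟩
        · push Not at h
          exact ⟨x, Or.inr h, hrefl x⟩) ⟨p, hp⟩
  -- The generic ideal meets every level below `a`, and directedness makes it meet each only once.
  -- The value 0 from `a` on ensures that branches agreeing below `a` are equal.
  have hI : ∀ c, ∃ k, (∀ h : c < a, (⟨(c, k), h⟩ : P) ∈ I) ∧ (a ≤ c → k = 0) := by
    intro c
    by_cases hc : c < a
    · obtain ⟨x, hcx, hx⟩ := hmeet (level c) (Or.inl ⟨c, hc, rfl⟩)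
      exact ⟨b x.1.1 x.1.2 c, fun h => hlow x hx _ ⟨hcx, rfl⟩, fun h => absurd hc h.not_gt⟩
    · exact ⟨0, fun h => absurd h hc, fun _ => rfl⟩
  choose f hf hf0 using hI
  have huniq : ∀ x ∈ I, f x.1.1 = x.1.2 := by
    intro x hx
    obtain ⟨z, -, h1, h2⟩ := hdir x hx _ (hf x.1.1 x.2)
    exact h2.2.symm.trans h1.2
  refine ⟨f, huniq _ hpI, ?_, ?_, hf0⟩
  · intro d c hdc hc
    exact huniq ⟨(d, b c (f c) d), hdc.trans_lt hc⟩ (hlow _ (hf c hc) _ ⟨hdc, rfl⟩)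
  · intro A hA
    obtain ⟨x, hxA, hx⟩ := hmeet (decide A) (Or.inr ⟨A, hA, rfl⟩)
    refine ⟨x.1.1, x.2, ?_⟩
    rw [huniq x hx]
    exact hxA.imp_right fun h z hz hle => h ⟨z, hz⟩ hle

theorem exists_goodLevel_of_isLimitPoint (ha : IsLimitPoint a) (hcount : (Set.Iio a).Countable)
    (hS : (S a).Countable) (hb : ∀ c < a, GoodLevel S b c) :
    ∃ v, GoodLevel S (Function.update b a v) a := by
  classical
  choose br hbr hcoh hgen hzero using fun p : {x : W × ℕ // x.1 < a} =>
    exists_branch hcount hS hb p.1 p.2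
  have : Countable {x : W × ℕ // x.1 < a} := by
    have : ({x : W × ℕ | x.1 < a}).Countable := by
      refine (hcount.prod (Set.countable_univ (α := ℕ))).mono ?_
      exact fun x hx => ⟨hx, trivial⟩
    exact this.to_subtype
  obtain ⟨c₀, hc₀⟩ := ha.1
  -- Branches, not the nodes they pass through, are numbered without repetition, which gives `inj`.
  -- There are infinitely many, as distinct nodes of level `c₀` lie on distinct branches.
  have : Infinite (Set.range br) := by
    refine Infinite.of_injective (fun n : ℕ => (⟨_, ⟨(c₀, n), hc₀⟩, rfl⟩ : Set.range br)) ?_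
    intro n n' h
    have h' := congrFun (congrArg Subtype.val h) c₀
    simpa only [hbr ⟨(c₀, n), hc₀⟩, hbr ⟨(c₀, n'), hc₀⟩] using h'
  have := (Set.countable_range br).to_subtype
  obtain ⟨_⟩ := nonempty_denumerable (Set.range br)
  let e : ℕ ≃ Set.range br := (Denumerable.eqv _).symm
  let v : ℕ → W → ℕ := fun n c => if c < a then (e n).1 c else n
  have hv : ∀ n, ∀ c < a, v n c = (e n).1 c := fun n c hc => if_pos hc
  have hve : ∀ p, ∃ n, ∀ c < a, v n c = br p c := fun p =>
    ⟨e.symm ⟨_, p, rfl⟩, fun c hc => by simp [v, hc]⟩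
  have hev : ∀ n, ∃ p, (e n).1 = br p := fun n => by
    obtain ⟨p, hp⟩ := (e n).2
    exact ⟨p, hp.symm⟩
  have hu : ∀ c < a, Function.update b a v c = b c := fun c hc =>
    Function.update_of_ne hc.ne _ _
  refine ⟨v, ?_, ?_, ?_, ?_, ?_⟩
  · simp [v]
  · intro d c hdc hc n
    obtain ⟨p, hp⟩ := hev n
    rw [hu c hc, Function.update_self, hv n c hc, hv n d (hdc.trans_lt hc), hp]
    exact hcoh p d c hdc hc
  · intro c hc m
    rw [Function.update_self]
    -- The node already splits at a level `d` between `c` and `a`; the branches through the two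
    -- halves remain distinct.
    obtain ⟨d, hcd, hd⟩ := ha.2 c hc
    obtain ⟨k, k', hkk, hk, hk'⟩ := (hb d hd).split c hcd m
    obtain ⟨n, hn⟩ := hve ⟨(d, k), hd⟩
    obtain ⟨n', hn'⟩ := hve ⟨(d, k'), hd⟩
    have h1 : br ⟨(d, k), hd⟩ d = k := hbr ⟨(d, k), hd⟩
    have h2 : br ⟨(d, k'), hd⟩ d = k' := hbr ⟨(d, k'), hd⟩
    refine ⟨n, n', ?_, ?_, ?_⟩
    · rintro rfl
      exact hkk (h1.symm.trans (((hn d hd).symm.trans (hn' d hd)).trans h2))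
    · rw [hn c hc, hcoh _ c d hcd.le hd, h1, hk]
    · rw [hn' c hc, hcoh _ c d hcd.le hd, h2, hk']
  · intro _ n n' h
    rw [Function.update_self] at h
    apply e.injective
    apply Subtype.ext
    obtain ⟨p, hp⟩ := hev n
    obtain ⟨p', hp'⟩ := hev n'
    funext c
    rcases lt_or_ge c a with hc | hc
    · rw [← hv n c hc, ← hv n' c hc, h c hc]
    · rw [hp, hp', hzero p c hc, hzero p' c hc]
  · intro _ A hA n
    obtain ⟨p, hp⟩ := hev n
    obtain ⟨c, hc, h⟩ := hgen p A hA
    refine ⟨c, hc, ?_⟩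
    rw [Function.update_self, hv n c hc, hp]
    refine h.imp_right fun h z hz hle => h z hz ?_
    rwa [NodeLE, hu _ hz] at hle

theorem exists_goodLevel_of_not_isLimitPoint (ha : ¬ IsLimitPoint a)
    (hb : ∀ c < a, GoodLevel S b c) : ∃ v, GoodLevel S (Function.update b a v) a := by
  classical
  by_cases h0 : ∃ c, c < a
  · have h1 : ∃ d < a, ∀ c < a, c ≤ d := by
      by_contra! h
      exact ha ⟨h0, fun c hc => (h c hc).imp fun d hd => hd.symm⟩
    obtain ⟨d, hd, hmax⟩ := h1
    have hu : ∀ v : ℕ → W → ℕ, ∀ c < a, Function.update b a v c = b c := fun v c hc =>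
      Function.update_of_ne hc.ne _ _
    -- Via the pairing function, each node of the last level `d` gets infinitely many immediate
    -- successors.
    refine ⟨fun n c => if c < a then b d n.unpair.1 c else n, ?_, ?_, ?_,
      fun h => absurd h ha, fun h => absurd h ha⟩
    · simp
    · intro e c hec hc n
      rw [hu _ c hc]
      simp only [Function.update_self, hc, hec.trans_lt hc, if_true]
      exact (hb d hd).coherent_le hec (hmax c hc) _
    · intro c hc m
      obtain ⟨k, hk⟩ := (hb d hd).exists_eq (hmax c hc) m
      exact ⟨Nat.pair k 0, Nat.pair k 1, by simp [Nat.pair_eq_pair],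
        by simp [hc, hk], by simp [hc, hk]⟩
  · push Not at h0
    -- The minimal level consists of infinitely many roots.
    refine ⟨fun n _ => n, ?_, ?_, ?_, fun h => absurd h ha, fun h => absurd h ha⟩
    · simp
    · exact fun d c _ hc => absurd hc (h0 c).not_gt
    · exact fun c hc => absurd hc (h0 c).not_gt

theorem exists_goodLevel [WellFoundedLT W] (hcount : ∀ a : W, (Set.Iio a).Countable)
    (hS : ∀ a, (S a).Countable) : ∃ b, ∀ a, GoodLevel S b a := by
  refine exists_forall_of_update (GoodLevel S) (fun b b' a h => GoodLevel.congr h) ?_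
  intro b a hb
  by_cases ha : IsLimitPoint a
  · exact exists_goodLevel_of_isLimitPoint ha (hcount a) (hS a) hb
  · exact exists_goodLevel_of_not_isLimitPoint ha hb

/-- `x` decides `A` from below: it has a proper predecessor which lies in `A` or has no successor
in `A`. -/
def DecidesBelow (b : W → ℕ → W → ℕ) (A : Set (W × ℕ)) (x : W × ℕ) : Prop :=
  ∃ y : W × ℕ, y.1 < x.1 ∧ NodeLE b y x ∧ (y ∈ A ∨ ∀ z, NodeLE b y z → z ∉ A)

/-- If the sequence `S` guesses `A` on a club, then on a club all nodes decide `A`. -/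
theorem exists_isClub_decidesBelow [WellFoundedLT W]
    (hW : ∀ s : Set W, s.Countable → ∃ b, ∀ a ∈ s, a < b)
    (hcount : ∀ a : W, (Set.Iio a).Countable) (hcof : Order.cof W ≠ ℵ₀)
    (hb : ∀ a, GoodLevel S b a) (A : Set (W × ℕ)) {C : Set W} (hC : IsClub C)
    (hCA : ∀ a ∈ C, {x ∈ A | x.1 < a} ∈ S a) :
    ∃ C' : Set W, IsClub C' ∧ ∀ a ∈ C', ∀ n, DecidesBelow b A (a, n) := by
  have hwit : ∀ x : W × ℕ, ∃ c, (∃ z ∈ A, NodeLE b x z) → ∃ z ∈ A, NodeLE b x z ∧ z.1 = c := by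
    intro x
    by_cases h : ∃ z ∈ A, NodeLE b x z
    · obtain ⟨z, hz⟩ := h
      exact ⟨z.1, fun _ => ⟨z, hz.1, hz.2, rfl⟩⟩
    · exact ⟨x.1, fun h' => absurd h' h⟩
  choose w hw using hwit
  have hbound : ∀ c : W, ∃ d, c < d ∧ ∀ n, w (c, n) < d := by
    intro c
    obtain ⟨d, hd⟩ := hW (insert c (Set.range fun n => w (c, n)))
      ((Set.countable_range _).insert c)
    exact ⟨d, hd c (Set.mem_insert _ _), fun n => hd _ (Set.mem_insert_of_mem _ ⟨n, rfl⟩)⟩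
  choose f hf hwf using hbound
  refine ⟨_, hC.inter hcof (isClub_closurePoints hW hcount f), ?_⟩
  rintro a ⟨haC, ha0, haf⟩ n
  have hlim : IsLimitPoint a := ⟨ha0, fun c hc => ⟨f c, hf c, haf c hc⟩⟩
  obtain ⟨c, hc, h⟩ := (hb a).generic hlim _ (hCA a haC) n
  refine ⟨(c, b a n c), hc, ⟨hc.le, rfl⟩, h.imp (fun h => h.1) ?_⟩
  intro h z hz hzA
  -- If the node has any extension in `A`, then it has one at level `w`, which is below `a` because
  -- `a` is closed under `f`.
  obtain ⟨z', hzA', hle, hz'⟩ := hw _ ⟨z, hzA, hz⟩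
  have hlt : z'.1 < a := hz' ▸ (hwf c _).trans (haf c hc)
  exact h z' hlt hle ⟨hzA', hlt⟩

end BranchSystem

/-! ### The first uncountable ordinal -/

/-- The type of the countable ordinals. -/
abbrev OmegaOne : Type (u + 1) := Set.Iio (ω₁ : Ordinal.{u})

theorem OmegaOne.countable_Iio (a : OmegaOne.{u}) : (Set.Iio a).Countable := by
  have h : (Set.Iio (a : Ordinal.{u})).Countable := by
    rw [← Cardinal.le_aleph0_iff_set_countable, Cardinal.mk_Iio_ordinal, Cardinal.lift_le_aleph0,
      ← Cardinal.lt_aleph_one_iff, ← Cardinal.lt_ord, Cardinal.ord_aleph]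
    exact a.2
  exact h.preimage Subtype.val_injective

theorem OmegaOne.exists_gt (s : Set OmegaOne.{u}) (hs : s.Countable) : ∃ b, ∀ a ∈ s, a < b := by
  have := hs.to_subtype
  have hlt : ⨆ a : s, Order.succ (a.1 : Ordinal.{u}) < ω₁ :=
    Ordinal.iSup_lt_omega_one fun a => (Cardinal.isSuccLimit_omega 1).succ_lt a.1.2
  refine ⟨⟨_, hlt⟩, fun a ha => ?_⟩
  exact (Order.lt_succ a.1).trans_le
    (Ordinal.le_iSup (fun a : s => Order.succ (a.1 : Ordinal.{u})) ⟨a, ha⟩)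

theorem OmegaOne.cof_ne : Order.cof OmegaOne.{u} ≠ ℵ₀ := by
  rw [Ordinal.cof_Iio, ← Ordinal.lift_cof, Cardinal.cof_omega_one]
  simpa using Cardinal.aleph0_lt_aleph_one.ne'

theorem OmegaOne.exists_injective : ∃ p : OmegaOne.{u} × ℕ → OmegaOne.{u}, p.Injective := by
  have h : #(OmegaOne.{u} × ℕ) = #OmegaOne.{u} := by
    rw [Cardinal.mk_prod, Cardinal.mk_nat, Cardinal.lift_aleph0, Cardinal.lift_uzero]
    refine Cardinal.mul_aleph0_eq ?_
    rw [Cardinal.mk_Iio_ordinal]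
    simp
  obtain ⟨e⟩ := Cardinal.eq.1 h
  exact ⟨e, e.injective⟩

/-- The diamond-star principle for subsets of `ω₁ × ω`. -/
theorem diamondStar_prod (h : DiamondStar.{u}) :
    ∃ S : OmegaOne.{u} → Set (Set (OmegaOne.{u} × ℕ)), (∀ a, (S a).Countable) ∧
      ∀ A : Set (OmegaOne.{u} × ℕ), ∃ C : Set OmegaOne.{u}, IsClub C ∧
        ∀ a ∈ C, {x ∈ A | x.1 < a} ∈ S a := by
  obtain ⟨S, hS, hguess⟩ := h
  obtain ⟨p, hp⟩ := OmegaOne.exists_injective.{u}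
  refine ⟨fun a => (fun Y => {x | x.1 < a ∧ (p x : Ordinal.{u}) ∈ Y}) '' S a,
    fun a => (hS a).1.image _, fun A => ?_⟩
  obtain ⟨C, hC, hCS⟩ := hguess ((fun x => (p x : Ordinal.{u})) '' A) (by
    rintro _ ⟨x, -, rfl⟩
    exact (p x).2)
  -- On a club of `a`, the coding `p` sends nodes below `a` to ordinals below `a`, so the guess of
  -- the coded set at `a` retains all nodes of `A` below `a`.
  have hbound : ∀ c : OmegaOne.{u}, ∃ d, ∀ n, p (c, n) < d := by
    intro c
    obtain ⟨d, hd⟩ := OmegaOne.exists_gt _ (Set.countable_range fun n => p (c, n))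
    exact ⟨d, fun n => hd _ ⟨n, rfl⟩⟩
  choose f hf using hbound
  refine ⟨_, hC.inter OmegaOne.cof_ne
    (isClub_closurePoints OmegaOne.exists_gt OmegaOne.countable_Iio f), ?_⟩
  rintro a ⟨haC, -, haf⟩
  refine ⟨_, hCS a haC, ?_⟩
  ext x
  constructor
  · rintro ⟨hx, ⟨y, hy, hyx⟩, -⟩
    obtain rfl : y = x := hp (Subtype.ext hyx)
    exact ⟨hy, hx⟩
  · rintro ⟨hxA, hx⟩
    exact ⟨hx, ⟨x, hxA, rfl⟩, (hf x.1 x.2).trans (haf _ hx)⟩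

/-! ### The tree of a coherent system of branches, as a set -/

/-- The set representing the `x.2`-th node of level `x.1`. -/
noncomputable def nodeSet (x : OmegaOne.{u} × ℕ) : ZFSet.{u} :=
  ZFSet.pair (x.1 : Ordinal.{u}).toZFSet (x.2 : Ordinal.{u}).toZFSet

theorem nodeSet_injective : Function.Injective nodeSet.{u} := by
  rintro ⟨a, m⟩ ⟨c, n⟩ h
  obtain ⟨h1, h2⟩ := ZFSet.pair_inj.1 h
  exact Prod.ext (Subtype.ext (Ordinal.toZFSet_injective h1))
    (Nat.cast_injective (Ordinal.toZFSet_injective h2))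

/-- The strict order of the tree given by `b`. -/
def NodeLT (b : OmegaOne.{u} → ℕ → OmegaOne.{u} → ℕ) (x y : OmegaOne.{u} × ℕ) : Prop :=
  x.1 < y.1 ∧ b y.1 y.2 x.1 = x.2

/-- The strict order of the tree given by `b`, as a set of ordered pairs. -/
noncomputable def orderSet (b : OmegaOne.{u} → ℕ → OmegaOne.{u} → ℕ) : ZFSet.{u} :=
  ZFSet.range fun q : {q : (OmegaOne.{u} × ℕ) × (OmegaOne.{u} × ℕ) // NodeLT b q.1 q.2} =>
    ZFSet.pair (nodeSet q.1.1) (nodeSet q.1.2)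

section Tree

variable {b : OmegaOne.{u} → ℕ → OmegaOne.{u} → ℕ} {S : OmegaOne.{u} → Set (Set (OmegaOne.{u} × ℕ))}

theorem pair_mem_orderSet {y z : ZFSet.{u}} :
    ZFSet.pair y z ∈ orderSet b ↔ ∃ v w, nodeSet v = y ∧ nodeSet w = z ∧ NodeLT b v w := by
  rw [orderSet, ZFSet.mem_range]
  constructor
  · rintro ⟨⟨q, hq⟩, h⟩
    obtain ⟨h1, h2⟩ := ZFSet.pair_inj.1 h
    exact ⟨_, _, h1, h2, hq⟩
  · rintro ⟨v, w, rfl, rfl, h⟩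
    exact ⟨⟨(v, w), h⟩, rfl⟩

theorem pair_nodeSet_mem_orderSet {v w : OmegaOne.{u} × ℕ} :
    ZFSet.pair (nodeSet v) (nodeSet w) ∈ orderSet b ↔ NodeLT b v w := by
  rw [pair_mem_orderSet]
  constructor
  · rintro ⟨v', w', hv, hw, h⟩
    rwa [nodeSet_injective hv, nodeSet_injective hw] at h
  · exact fun h => ⟨v, w, rfl, rfl, h⟩

theorem NodeLE.trans (hb : ∀ a, GoodLevel S b a) {x y z : OmegaOne.{u} × ℕ} (hxy : NodeLE b x y)
    (hyz : NodeLE b y z) : NodeLE b x z :=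
  ⟨hxy.1.trans hyz.1, by rw [(hb _).coherent_le hxy.1 hyz.1, hyz.2, hxy.2]⟩

theorem NodeLT.le {x y : OmegaOne.{u} × ℕ} (h : NodeLT b x y) : NodeLE b x y := ⟨h.1.le, h.2⟩

/-- The predecessors of a node of level `a` are ordered as the ordinals below `a`. -/
theorem nonempty_predecessors_relIso (hb : ∀ a, GoodLevel S b a) (x : OmegaOne.{u} × ℕ) :
    Nonempty ((fun v w : {y : ZFSet.{u} // ZFSet.pair y (nodeSet x) ∈ orderSet b} =>
        ZFSet.pair (v : ZFSet.{u}) (w : ZFSet.{u}) ∈ orderSet b) ≃r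
      (fun c d : Set.Iio (x.1 : Ordinal.{u}) => c < d)) := by
  let up : Set.Iio (x.1 : Ordinal.{u}) → OmegaOne.{u} := fun c => ⟨c, lt_trans (Set.mem_Iio.1 c.2) x.1.2⟩
  let F : Set.Iio (x.1 : Ordinal.{u}) →
      {y : ZFSet.{u} // ZFSet.pair y (nodeSet x) ∈ orderSet b} := fun c =>
    ⟨nodeSet (up c, b x.1 x.2 (up c)), pair_nodeSet_mem_orderSet.2 ⟨c.2, rfl⟩⟩
  have hF : Function.Bijective F := by
    constructor
    · intro c d h
      have h' := congrArg Prod.fst (nodeSet_injective (congrArg Subtype.val h))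
      exact Subtype.ext (congrArg (fun a : OmegaOne.{u} => (a : Ordinal.{u})) h')
    · rintro ⟨y, hy⟩
      obtain ⟨v, w, rfl, hw, hlt, h⟩ := pair_mem_orderSet.1 hy
      obtain rfl := nodeSet_injective hw
      exact ⟨⟨v.1, hlt⟩, Subtype.ext (congrArg nodeSet (Prod.ext rfl h))⟩
  refine ⟨RelIso.symm ⟨Equiv.ofBijective F hF, ?_⟩⟩
  intro c d
  refine pair_nodeSet_mem_orderSet.trans ⟨fun h => h.1, fun h => ⟨h, ?_⟩⟩
  -- By coherence, two predecessors of `x` are comparable as soon as their levels are.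
  exact ((hb x.1).coherent_le (le_of_lt (show up c < up d from h)) (le_of_lt d.2) x.2).symm

/-- The tree of a coherent system of branches. -/
noncomputable def branchTree (hb : ∀ a, GoodLevel S b a) : SetTree.{u} where
  carrier := ZFSet.range nodeSet.{u}
  order := orderSet b
  order_subset := by
    intro q hq
    obtain ⟨q, rfl⟩ := ZFSet.mem_range.1 hq
    rw [ZFSet.pair_mem_prod]
    exact ⟨ZFSet.mem_range_self _, ZFSet.mem_range_self _⟩
  irrefl := by
    intro x hx
    obtain ⟨v, w, hv, hw, h, -⟩ := pair_mem_orderSet.1 hx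
    rw [nodeSet_injective (hv.trans hw.symm)] at h
    exact h.false
  trans := by
    intro x y z hxy hyz
    obtain ⟨v, w, rfl, rfl, h⟩ := pair_mem_orderSet.1 hxy
    obtain ⟨w', t, hw, rfl, h'⟩ := pair_mem_orderSet.1 hyz
    obtain rfl := nodeSet_injective hw
    exact pair_nodeSet_mem_orderSet.2 ⟨h.1.trans h'.1, (h.le.trans hb h'.le).2⟩
  wellOrder := by
    intro x
    by_cases hx : ∃ v, nodeSet v = x
    · obtain ⟨v, rfl⟩ := hx
      obtain ⟨e⟩ := nonempty_predecessors_relIso hb v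
      exact e.toRelEmbedding.isWellOrder
    · have : IsEmpty {y : ZFSet.{u} // ZFSet.pair y x ∈ orderSet b} := by
        refine ⟨fun y => hx ?_⟩
        obtain ⟨_, w, -, hw, -⟩ := pair_mem_orderSet.1 y.2
        exact ⟨w, hw⟩
      infer_instance

variable (hb : ∀ a, GoodLevel S b a)

theorem branchTree_lt {v w : OmegaOne.{u} × ℕ} :
    (branchTree hb).Lt (nodeSet v) (nodeSet w) ↔ NodeLT b v w :=
  pair_nodeSet_mem_orderSet

theorem exists_of_branchTree_lt {y z : ZFSet.{u}} (h : (branchTree hb).Lt y z) :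
    ∃ v w, nodeSet v = y ∧ nodeSet w = z ∧ NodeLT b v w :=
  pair_mem_orderSet.1 h

theorem mem_branchTree_carrier {x : ZFSet.{u}} :
    x ∈ (branchTree hb).carrier ↔ ∃ v, nodeSet v = x :=
  ZFSet.mem_range

theorem mem_branchTree_level {x : ZFSet.{u}} {β : Ordinal.{u}} :
    x ∈ (branchTree hb).level β ↔ ∃ v, nodeSet v = x ∧ (v.1 : Ordinal.{u}) = β := by
  constructor
  · rintro ⟨hx, ⟨e⟩⟩
    obtain ⟨v, rfl⟩ := (mem_branchTree_carrier hb).1 hx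
    obtain ⟨e'⟩ := nonempty_predecessors_relIso hb v
    refine ⟨v, rfl, ?_⟩
    have h := (e'.symm.trans e).ordinalType_congr
    change Ordinal.type (α := Set.Iio (v.1 : Ordinal.{u})) (· < ·) =
      Ordinal.type (α := Set.Iio β) (· < ·) at h
    rw [Ordinal.type_lt_Iio, Ordinal.type_lt_Iio] at h
    exact Ordinal.lift_inj.1 h
  · rintro ⟨v, rfl, rfl⟩
    exact ⟨(mem_branchTree_carrier hb).2 ⟨v, rfl⟩, nonempty_predecessors_relIso hb v⟩

theorem branchTree_isOmegaOneTree : (branchTree hb).IsOmegaOneTree where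
  nonempty := ⟨_, (mem_branchTree_carrier hb).2
    ⟨(⟨0, Ordinal.omega_pos 1⟩, 0), rfl⟩⟩
  rank_lt := by
    intro x hx
    obtain ⟨v, rfl⟩ := (mem_branchTree_carrier hb).1 hx
    exact ⟨v.1, v.1.2, (mem_branchTree_level hb).2 ⟨v, rfl, rfl⟩⟩
  countable_level := by
    intro β hβ
    refine (Set.countable_range fun n : ℕ => nodeSet (⟨β, hβ⟩, n)).mono fun x hx => ?_
    obtain ⟨⟨a, n⟩, rfl, rfl⟩ := (mem_branchTree_level hb).1 hx
    exact ⟨n, rfl⟩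
  two_successors := by
    intro α β hαβ hβ x hx
    obtain ⟨⟨a, m⟩, rfl, rfl⟩ := (mem_branchTree_level hb).1 hx
    obtain ⟨n, n', hne, hn, hn'⟩ := (hb ⟨β, hβ⟩).split a hαβ m
    refine ⟨nodeSet (⟨β, hβ⟩, n), (mem_branchTree_level hb).2 ⟨_, rfl, rfl⟩,
      nodeSet (⟨β, hβ⟩, n'), (mem_branchTree_level hb).2 ⟨_, rfl, rfl⟩, ?_,
      (branchTree_lt hb).2 ⟨hαβ, hn⟩, (branchTree_lt hb).2 ⟨hαβ, hn'⟩⟩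
    exact fun h => hne (congrArg Prod.snd (nodeSet_injective h))
  limit_unique := by
    intro β hβ x hx y hy hxy
    obtain ⟨⟨a, n⟩, rfl, rfl⟩ := (mem_branchTree_level hb).1 hx
    obtain ⟨⟨a', n'⟩, rfl, ha'⟩ := (mem_branchTree_level hb).1 hy
    obtain rfl : a' = a := Subtype.ext ha'
    have hlim : IsLimitPoint a' := by
      constructor
      · exact ⟨⟨0, Ordinal.omega_pos 1⟩, hβ.bot_lt⟩
      · intro c hc
        have h := hβ.succ_lt (show (c : Ordinal.{u}) < a' from hc)
        exact ⟨⟨Order.succ c.1, h.trans a'.2⟩, Order.lt_succ c.1, h⟩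
    refine congrArg nodeSet (Prod.ext rfl ((hb a').inj hlim n n' fun c hc => ?_))
    have h := (branchTree_lt hb).1 ((hxy (nodeSet (c, b a' n c))).1
      ((branchTree_lt hb).2 ⟨hc, rfl⟩))
    exact h.2.symm

/-- A set of nodes all of which lie below a fixed level is countable. -/
theorem countable_of_level_lt {B : Set ZFSet.{u}}
    (hB : B ⊆ ((branchTree hb).carrier : Set ZFSet.{u})) (a : OmegaOne.{u})
    (h : ∀ v, nodeSet v ∈ B → v.1 < a) : B.Countable := by
  refine (((OmegaOne.countable_Iio a).prod (Set.countable_univ (α := ℕ))).image nodeSet).mono ?_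
  intro x hx
  obtain ⟨v, rfl⟩ := (mem_branchTree_carrier hb).1 (hB hx)
  exact ⟨v, ⟨h v hx, trivial⟩, rfl⟩

variable (hdec : ∀ A, ∃ C : Set OmegaOne.{u}, IsClub C ∧ ∀ a ∈ C, ∀ n, DecidesBelow b A (a, n))

-- If a chain or antichain `B` had a node `v` at or above a level `a` of the relevant club, then the
-- predecessor of `v` at level `a` would decide the chosen set through some `y` below it, and both
-- outcomes are contradictory.
include hdec in
theorem branchTree_isSuslin : (branchTree hb).IsSuslin where
  isOmegaOneTree := branchTree_isOmegaOneTree hb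
  chain := by
    intro B hB hchain
    -- The set consists of the nodes not extended by `B`. Since `v` extends `y`, the only outcome
    -- left is that `B` is dense above `y`; but `y` splits at level `a`, and a chain cannot pass
    -- through both halves.
    obtain ⟨C, hC, hCA⟩ := hdec {x | ∀ y, nodeSet y ∈ B → ¬ NodeLE b x y}
    obtain ⟨a, ha, -⟩ := hC.isCofinal ⟨0, Ordinal.omega_pos 1⟩
    refine countable_of_level_lt hb hB a fun v hv => lt_of_not_ge fun hav => ?_
    obtain ⟨y, hya, hy, h⟩ := hCA a ha (b v.1 v.2 a)
    rcases h with h | h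
    · exact h v hv (hy.trans hb ⟨hav, rfl⟩)
    · obtain ⟨n, n', hne, hn, hn'⟩ := (hb a).split y.1 hya y.2
      have hz : ∀ k, b a k y.1 = y.2 → ∃ w, nodeSet w ∈ B ∧ NodeLE b (a, k) w := by
        intro k hk
        simpa using h (a, k) ⟨hya.le, hk⟩
      obtain ⟨w, hw, hle⟩ := hz n hn
      obtain ⟨w', hw', hle'⟩ := hz n' hn'
      have key : ∀ {k k' : ℕ} {t t' : OmegaOne.{u} × ℕ}, NodeLE b (a, k) t →
          NodeLE b (a, k') t' → NodeLE b t t' → k = k' := fun h1 h2 h3 =>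
        (h1.trans hb h3).2.symm.trans h2.2
      by_cases hww : nodeSet w = nodeSet w'
      · rw [nodeSet_injective hww] at hle
        exact hne (hle.2.symm.trans hle'.2)
      · rcases hchain hw hw' hww with h' | h'
        · exact hne (key hle hle' ((branchTree_lt hb).1 h').le)
        · exact hne (key hle' hle ((branchTree_lt hb).1 h').le).symm
  antichain := by
    intro B hB hanti
    obtain ⟨C, hC, hCA⟩ := hdec {x | nodeSet x ∈ B}
    obtain ⟨a, ha, -⟩ := hC.isCofinal ⟨0, Ordinal.omega_pos 1⟩
    refine countable_of_level_lt hb hB a fun v hv => lt_of_not_ge fun hav => ?_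
    obtain ⟨y, hya, hy, h⟩ := hCA a ha (b v.1 v.2 a)
    have hyv : NodeLE b y v := hy.trans hb ⟨hav, rfl⟩
    have hlt : y.1 < v.1 := lt_of_lt_of_le hya hav
    rcases h with h | h
    · refine hanti h hv (fun hyv' => ?_) ((branchTree_lt hb).2 ⟨hlt, hyv.2⟩)
      rw [nodeSet_injective hyv'] at hlt
      exact hlt.false
    · exact h v hyv hv

include hdec in
/-- For every subset `A` of the tree, on a club of levels all nodes satisfy the genericity
requirement given by `A`. -/
theorem exists_isClub_level_generic (A : ZFSet.{u}) :
    ∃ C : Set OmegaOne.{u}, IsClub C ∧ ∀ δ ∈ C, ∀ x ∈ (branchTree hb).level δ,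
      ∃ y, (branchTree hb).Lt y x ∧
        (y ∈ A ∨ ∀ z, (z = y ∨ (branchTree hb).Lt y z) → z ∉ A) := by
  obtain ⟨C, hC, hCA⟩ := hdec {x | nodeSet x ∈ A}
  refine ⟨C, hC, fun δ hδ x hx => ?_⟩
  obtain ⟨⟨a, n⟩, rfl, ha⟩ := (mem_branchTree_level hb).1 hx
  obtain rfl : a = δ := Subtype.ext ha
  obtain ⟨y, hya, hy, h⟩ := hCA a hδ n
  refine ⟨nodeSet y, (branchTree_lt hb).2 ⟨hya, hy.2⟩, h.imp_right fun h z hz => ?_⟩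
  rcases hz with rfl | hz
  · exact h y ⟨le_rfl, (hb _).self _⟩
  · obtain ⟨v, w, hv, rfl, hlt⟩ := exists_of_branchTree_lt hb hz
    obtain rfl := nodeSet_injective hv
    exact h w hlt.le

include hdec in
theorem branchTree_isSharplySuslin : (branchTree hb).IsSharplySuslin := by
  refine ⟨branchTree_isSuslin hb hdec, 0, fun κ _ _ M hM => ?_⟩
  -- The club depends only on `A`, not on `N`, so a single countable intersection serves all `N ∈
  -- M`.
  choose C hC hgen using exists_isClub_level_generic hb hdec
  let 𝒜 : Set ZFSet.{u} := ⋃ N ∈ {N : ZFSet.{u} | N ∈ M ∧ (N : Set ZFSet.{u}).Countable}, N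
  have h𝒜 : 𝒜.Countable :=
    (hM.1.mono fun N hN => hN.1).biUnion fun N hN => hN.2
  refine ⟨⋂₀ (C '' 𝒜), IsClub.sInter_of_countable OmegaOne.cof_ne (h𝒜.image C) ?_, ?_⟩
  · rintro _ ⟨A, -, rfl⟩
    exact hC A
  · intro N hNM hN _ δ hδ hNδ x hx
    refine ⟨⟨δ, hNδ, hx⟩, fun A hA _ => hgen A δ (hδ _ ⟨A, ?_, rfl⟩) x hx⟩
    exact Set.mem_biUnion (show N ∈ {N : ZFSet.{u} | N ∈ M ∧ _} from ⟨hNM, hN.1⟩) hA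

end Tree

theorem lemma4p4 (h : DiamondStar.{u}) : ∃ T : SetTree.{u}, T.IsSharplySuslin := by
  obtain ⟨S, hS, hguess⟩ := diamondStar_prod h
  obtain ⟨b, hb⟩ := exists_goodLevel OmegaOne.countable_Iio hS
  refine ⟨branchTree hb, branchTree_isSharplySuslin hb fun A => ?_⟩
  obtain ⟨C, hC, hCA⟩ := hguess A
  exact exists_isClub_decidesBelow OmegaOne.exists_gt OmegaOne.countable_Iio OmegaOne.cof_ne
    hb A hC hCA
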